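/- Let $E=\mathbb C/\Lambda$ be a complex torus, $\Lambda\subset\mathbb C$ a lattice, with Weierstrass functions $\wp(z)=z^{-2}+\sum_{\omega\in\Lambda\setminus 0}\big((z-\omega)^{-2}-\omega^{-2}\big)$ and $\zeta(z)=z^{-1}+\sum_{\omega\in\Lambda\setminus 0}\big((z-\omega)^{-1}+\omega^{-1}+z\omega^{-2}\big)$. Let $n\ge 1$ and let $p_1,\dots,p_{2n}\in\mathbb C$ represent $2n$ distinct points of $E$. For $i\neq j$ put $\wp_{ij}=\wp(p_i-p_j)$ and $\zeta_{ij}=\zeta(p_i-p_j)$, put $\wp_{ii}=\zeta_{ii}=0$, and let $\wp_i=\sum_j\wp_{ij}$ and $\hat\zeta_i=\sum_j(-1)^j\zeta_{ij}$. Then $$\sum_{i=1}^{2n}(-1)^i\wp_i \;=\; 2\Big(\sum_{\substack{i<j\\ i,j\text{ even}}}\wp_{ij}-\sum_{\substack{i<j\\ i,j\text{ odd}}}\wp_{ij}\Big)\;=\;\sum_{i=1}^{2n}(-1)^i\hat\zeta_i^{\,2}.$$ Moreover, let $C\subset\mathbb C^{2n+1}$, with coordinates $(x_0,x_1,\dots,x_{2n})$,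 be defined by the $2n$ equations $$x_i^2-x_0\sum_{j\ne i}\zeta_{ij}x_j-x_0-\tfrac34\wp_i x_0^2=0,\qquad 1\le i\le 2n,$$ let $H$ be the hyperplane $x_1+\cdots+x_{2n}=0$, and let $Q=0$. Then every analytic curve germ of $C$ at $Q$ whose tangent line at $Q$ lies in $H$ meets $H$ at $Q$ with multiplicity at least $4$ (possibly infinite). Here a curve germ is given by an injective analytic parametrization $t\mapsto x(t)$ with $x(0)=Q$, and the multiplicity is the vanishing order of $x_1(t)+\cdots+x_{2n}(t)$ at $t=0$. In particular, there are $\binom{2n}{n}$ sign vectors $\varepsilon\in\{\pm1\}^{2n}$ with $\sum_i\varepsilon_i=0$. For each of them there is exactly one analytic curve germ of $C$ at $Q$ with $x_0(t)=t^2$ and $x_i(t)=\varepsilon_i t+O(t^2)$ for $1\le i\le 2n$, and it meets $H$ at $Q$ with multiplicity at least $4$. -/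

import Mathlib

open Filter Topology

namespace GenLame

noncomputable section

/-- The Weierstrass zeta function of the lattice `Λ` spanned by a period pair,
`ζ(z) = 1/z + ∑_{ω ∈ Λ, ω ≠ 0} (1/(z - ω) + 1/ω + z/ω²)`.
The term of the sum at `ω = 0` is `1/z`, because `1/0 = 0`. -/
def weierstrassZeta (L : PeriodPair) (z : ℂ) : ℂ :=
  ∑' l : L.lattice, (1 / (z - l) + 1 / (l : ℂ) + z / (l : ℂ) ^ 2)

section Coefficients

variable (L : PeriodPair) {m : ℕ} (p : Fin m → ℂ)

/-- `ζ_{ij} = ζ(p_i - p_j)` for `i ≠ j`, and `ζ_{ii} = 0`. -/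
def zetaC (i j : Fin m) : ℂ := if i = j then 0 else weierstrassZeta L (p i - p j)

/-- `℘_{ij} = ℘(p_i - p_j)` for `i ≠ j`, and `℘_{ii} = 0`. -/
def wpC (i j : Fin m) : ℂ := if i = j then 0 else L.weierstrassP (p i - p j)

/-- `℘_i = ∑_{j ≠ i} ℘_{ij}` (the term `j = i` is zero). -/
def wpSum (i : Fin m) : ℂ := ∑ j, wpC L p i j

/-- The label in `{1, …, m}` of the index `i ∈ {0, …, m - 1}`. -/
def label (i : Fin m) : ℕ := (i : ℕ) + 1

/-- `ζ̂_i = ∑_j (-1)^j ζ_{ij}`, where `j` runs over the labels `1, …, m`. -/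
def zetaHat (i : Fin m) : ℂ := ∑ j, (-1) ^ label j * zetaC L p i j

/-- The polynomial
`f_i(x) = x_i² - x_0 ∑_{j ≠ i} ζ_{ij} x_j - x_0 - (3/4) ℘_i x_0²` on `ℂ^{m+1}` with coordinates
`(x_0, x_1, …, x_m)`; the coordinate labelled by the point `p i` is `x i.succ`. -/
def quadric (i : Fin m) (x : Fin (m + 1) → ℂ) : ℂ :=
  x i.succ ^ 2 - x 0 * ∑ j, zetaC L p i j * x j.succ - x 0 - 3 / 4 * wpSum L p i * x 0 ^ 2

/-- The affine algebraic set `C = {f_1 = ⋯ = f_m = 0}` in `ℂ^{m+1}`. -/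
def curveC : Set (Fin (m + 1) → ℂ) := {x | ∀ i, quadric L p i x = 0}

end Coefficients

/-- The linear form `f_0(x) = x_1 + ⋯ + x_m` on `ℂ^{m+1}`. -/
def globalForm (m : ℕ) : (Fin (m + 1) → ℂ) →ₗ[ℂ] ℂ :=
  ∑ i : Fin m, LinearMap.proj i.succ

/-- The hyperplane `H = {x_1 + ⋯ + x_m = 0}` (the global constraint). -/
def globalConstraint (m : ℕ) : Submodule ℂ (Fin (m + 1) → ℂ) :=
  LinearMap.ker (globalForm m)

section Germs

variable {V : Type*} [NormedAddCommGroup V] [NormedSpace ℂ V]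

/-- `γ` is a primitive (injective near `0`) analytic parametrization of a curve germ at `Q` that is
contained in `C`. -/
structure IsCurveGerm (C : Set V) (Q : V) (γ : ℂ → V) : Prop where
  analyticAt : AnalyticAt ℂ γ 0
  map_zero : γ 0 = Q
  mem : ∀ᶠ t in 𝓝 (0 : ℂ), γ t ∈ C
  injOn : ∃ U ∈ 𝓝 (0 : ℂ), Set.InjOn γ U

/-- `v` spans the tangent line at `γ 0` of the germ parametrized by `γ`: one has
`γ(t) = γ(0) + t^k (v + O(t))` with `k ≥ 1` and `v ≠ 0`. -/
def IsTangentVector (γ : ℂ → V) (v : V) : Prop :=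
  v ≠ 0 ∧ ∃ k : ℕ, 0 < k ∧ ∃ g : ℂ → V, AnalyticAt ℂ g 0 ∧ g 0 = v ∧
    ∀ᶠ t in 𝓝 (0 : ℂ), γ t = γ 0 + t ^ k • g t

end Germs

/-- The intersection multiplicity at the origin of the germ parametrized by `γ` with the
hyperplane `H`: the vanishing order at `t = 0` of the equation of `H` along `γ`.
It is `⊤` if the germ lies in `H`. -/
def intersectionMult {m : ℕ} (γ : ℂ → Fin (m + 1) → ℂ) : ℕ∞ :=
  analyticOrderAt (fun t => globalForm m (γ t)) 0

/-- `γ(t) = (x_0(t), …, x_m(t))` is a curve germ of `C` at the origin with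
`x_0(t) = t²` and `x_i(t) = ε_i t + O(t²)` for `1 ≤ i ≤ m`. -/
structure IsSignedBranch (L : PeriodPair) {m : ℕ} (p : Fin m → ℂ) (ε : Fin m → ℤˣ)
    (γ : ℂ → Fin (m + 1) → ℂ) : Prop where
  isCurveGerm : IsCurveGerm (curveC L p) 0 γ
  coord_zero : ∀ᶠ t in 𝓝 (0 : ℂ), γ t 0 = t ^ 2
  hasDerivAt : ∀ i : Fin m, HasDerivAt (fun t => γ t i.succ) ((ε i : ℤ) : ℂ) 0

end

end GenLame

/-! Everything rests on the Frobenius–Stickelberger relation (ζ(a)+ζ(b)+ζ(c))² = ℘(a)+℘(b)+℘(c) for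
a+b+c = 0 (`frobenius_stickelberger`), which follows from Liouville's theorem.

For signs s with ∑ s_i = 0, weight the relation for the points i, j, k by s_i s_j s_k and sum over
all triples. Terms involving only two of the indices vanish on summing over the third. What survives
comes from coinciding indices and gives ∑ s_i (∑_j s_j ζ_ij)² = ∑ s_i ℘_i
(`IsStickelbergerPair.sum_signed_sq`); alternating signs give the stated identity.

Along a germ tangent to H, put τ = √x_0 and z_i = x_i/τ. The equations become z_i² = 1 + τ ∑_j ζ_ij
z_j + (3/4)℘_i τ², so z_i = s_i + a_i τ + b_i τ² + o(τ²) with s_i = ±1. Tangency gives ∑ s_i = 0,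
skew-symmetry of ζ_ij gives ∑ a_i = 0, and the signed identity gives ∑ b_i = 0. Hence ∑ x_i = o(τ³),
which forces order at least 4. The signed branches themselves come from the implicit function
theorem applied to the equations for z. -/

namespace GenLame

/-! ### The Weierstrass zeta function: convergence, derivative, quasi-periods -/

lemma zeta_summand_bound (r : ℝ) (s : ℂ) (hs : ‖s‖ < r) (l : ℂ) (hr : 0 < r)
    (h : 2 * r ≤ ‖l‖) :
    ‖1 / (s - l) + 1 / l + s / l ^ 2‖ ≤ 2 * r ^ 2 * ‖l‖ ^ (-3 : ℝ) := by
  have hl : 0 < ‖l‖ := by linarith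
  have hl0 : l ≠ 0 := norm_pos_iff.mp hl
  have hsl : s - l ≠ 0 := by
    intro e
    rw [sub_eq_zero.mp e] at hs
    linarith
  have h1 : ‖l‖ / 2 ≤ ‖s - l‖ := by
    rw [norm_sub_rev]
    exact .trans (by linarith) (norm_sub_norm_le l s)
  -- Over a common denominator the three terms collapse to s²/((s - l) l²). The resulting cubic
  -- decay is summable on a lattice of rank 2.
  calc
    _ = ‖s ^ 2 / ((s - l) * l ^ 2)‖ := by
      congr 1
      field_simp
      ring
    _ = ‖s‖ ^ 2 / (‖s - l‖ * ‖l‖ ^ 2) := by simp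
    _ ≤ r ^ 2 / (‖l‖ / 2 * ‖l‖ ^ 2) := by gcongr
    _ = 2 * r ^ 2 / ‖l‖ ^ 3 := by field
    _ = _ := by
      rw [div_eq_mul_inv]
      norm_cast

noncomputable section

/-- The regular part of the zeta function at the origin. -/
def zetaRegular (L : PeriodPair) (z : ℂ) : ℂ :=
  ∑' l : L.lattice, if l.1 = 0 then 0 else (1 / (z - l) + 1 / (l : ℂ) + z / (l : ℂ) ^ 2)

end

variable (L : PeriodPair)

lemma hasSumLocallyUniformly_zetaRegular :
    HasSumLocallyUniformly (fun (l : L.lattice) (z : ℂ) ↦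
      if l.1 = 0 then 0 else (1 / (z - l) + 1 / (l : ℂ) + z / (l : ℂ) ^ 2)) (zetaRegular L) := by
  refine L.hasSumLocallyUniformly_aux (u := fun r l ↦ 2 * r ^ 2 * ‖l‖ ^ (-3 : ℝ)) _
    (fun _ _ ↦ (ZLattice.summable_norm_rpow _ _ (by simp; norm_num)).mul_left _) fun r hr ↦
    Filter.eventually_atTop.mpr ⟨2 * r, ?_⟩
  rintro _ h s hs l rfl
  split_ifs
  · rw [norm_zero]
    positivity
  · exact zeta_summand_bound r s hs l hr h

lemma isOpen_compl_lattice_sdiff_zero : IsOpen ((L.lattice : Set ℂ) \ {0})ᶜ :=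
  L.isOpen_compl_lattice_sdiff

lemma differentiableOn_zeta_summand (l : L.lattice) :
    DifferentiableOn ℂ (fun z : ℂ ↦
      if l.1 = 0 then 0 else (1 / (z - l) + 1 / (l : ℂ) + z / (l : ℂ) ^ 2))
      ((L.lattice : Set ℂ) \ {0})ᶜ := by
  split_ifs with hl
  · simp
  · refine .add (.add (.div (by fun_prop) (by fun_prop) fun x hx ↦ ?_) (by fun_prop))
      (by fun_prop)
    rintro e
    rw [sub_eq_zero] at e
    exact hx ⟨e ▸ l.2, by simpa [e] using hl⟩

lemma differentiableOn_zetaRegular :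
    DifferentiableOn ℂ (zetaRegular L) ((L.lattice : Set ℂ) \ {0})ᶜ :=
  (hasSumLocallyUniformly_zetaRegular L).hasSumLocallyUniformlyOn.differentiableOn
    (.of_forall fun _ ↦ .fun_sum fun i _ ↦ differentiableOn_zeta_summand L i)
    (isOpen_compl_lattice_sdiff_zero L)

/-- Locally uniform convergence permits termwise differentiation, and each term differentiates to
minus the corresponding ℘ term. -/
lemma deriv_zetaRegular {z : ℂ} (hz : z ∈ ((L.lattice : Set ℂ) \ {0})ᶜ) :
    deriv (zetaRegular L) z = -L.weierstrassPExcept 0 z := by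
  have key : Set.EqOn (deriv (zetaRegular L)) (fun z ↦ -L.weierstrassPExcept 0 z)
      ((L.lattice : Set ℂ) \ {0})ᶜ := by
    refine ((hasSumLocallyUniformly_zetaRegular L).tendstoLocallyUniformlyOn.deriv
      (.of_forall fun s ↦ .fun_sum fun i _ ↦ differentiableOn_zeta_summand L i)
      (isOpen_compl_lattice_sdiff_zero L)).unique ?_
    refine (L.hasSumLocallyUniformly_weierstrassPExcept 0).tendstoLocallyUniformlyOn.fun_neg.congr ?_
    intro s x hx
    simp only [Function.comp_apply]
    rw [deriv_fun_sum fun i _ ↦ (differentiableOn_zeta_summand L i).differentiableAt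
      ((isOpen_compl_lattice_sdiff_zero L).mem_nhds hx), ← Finset.sum_neg_distrib]
    refine Finset.sum_congr rfl fun l _ ↦ ?_
    by_cases hl : l.1 = 0
    · simp [hl]
    · simp only [hl, if_false]
      have hxl : x - l ≠ 0 := by
        intro e
        rw [sub_eq_zero] at e
        exact hx ⟨e ▸ l.2, by simpa [e] using hl⟩
      have h1 : HasDerivAt (fun z : ℂ ↦ 1 / (z - l) + 1 / (l : ℂ) + z / (l : ℂ) ^ 2)
          (-1 / (x - l) ^ 2 + 1 / (l : ℂ) ^ 2) x := by
        have h2 := ((hasDerivAt_id x).sub_const (l : ℂ)).fun_inv hxl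
        have h3 := (hasDerivAt_id x).div_const ((l : ℂ) ^ 2)
        simpa using (h2.add_const (1 / (l : ℂ))).fun_add h3
      rw [h1.deriv]
      ring
  exact key hz

lemma weierstrassZeta_eq (z : ℂ) : weierstrassZeta L z = zetaRegular L z + 1 / z := by
  symm
  trans zetaRegular L z + ∑' i : L.lattice, if i = 0 then 1 / z else 0
  · simp
  rw [zetaRegular, ← Summable.tsum_add]
  · unfold weierstrassZeta
    congr with w
    by_cases hw : w = 0
    · simp [hw]
    · have : w.1 ≠ 0 := by simpa using hw
      simp [hw]
  · exact ⟨_, (hasSumLocallyUniformly_zetaRegular L).hasSum⟩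
  · exact summable_of_hasFiniteSupport ((Set.finite_singleton (0 : L.lattice)).subset (by simp))

lemma zetaRegular_neg (z : ℂ) : zetaRegular L (-z) = -zetaRegular L z := by
  simp only [zetaRegular]
  rw [← (Equiv.neg L.lattice).tsum_eq, ← tsum_neg]
  congr with l
  by_cases hl : l.1 = 0
  · simp [hl]
  · simp only [Equiv.neg_apply, NegMemClass.coe_neg, neg_eq_zero, hl, if_false, neg_sq]
    rw [show -z - -(l : ℂ) = -(z - l) by ring, div_neg, div_neg]
    ring

lemma zetaRegular_zero : zetaRegular L 0 = 0 := by
  simpa [CharZero.eq_neg_self_iff] using zetaRegular_neg L 0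

lemma weierstrassZeta_neg (z : ℂ) : weierstrassZeta L (-z) = -weierstrassZeta L z := by
  rw [weierstrassZeta_eq, weierstrassZeta_eq, zetaRegular_neg, div_neg]
  ring

lemma hasDerivAt_weierstrassZeta {z : ℂ} (hz : z ∉ L.lattice) :
    HasDerivAt (weierstrassZeta L) (-L.weierstrassP z) z := by
  have hz' : z ∈ ((L.lattice : Set ℂ) \ {0})ᶜ := by simp [hz]
  have hz0 : z ≠ 0 := by
    rintro rfl
    exact hz (zero_mem _)
  have h1 := ((differentiableOn_zetaRegular L).differentiableAt
    ((isOpen_compl_lattice_sdiff_zero L).mem_nhds hz')).hasDerivAt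
  rw [deriv_zetaRegular L hz'] at h1
  have h2 := h1.fun_add ((hasDerivAt_id z).fun_inv hz0)
  rw [show weierstrassZeta L = fun z ↦ zetaRegular L z + (id z)⁻¹ by
    ext z; simp [weierstrassZeta_eq]]
  refine h2.congr_deriv ?_
  have := L.weierstrassPExcept_add 0 z
  simp only [ZeroMemClass.coe_zero, sub_zero] at this
  rw [← this]
  simp
  ring

lemma notMem_add_coe {z : ℂ} (hz : z ∉ L.lattice) (l : L.lattice) : z + l ∉ L.lattice :=
  fun h ↦ hz (by simpa using sub_mem h l.2)

/-- Since ζ' = -℘ is periodic, the increment has derivative zero; the complement of a countable set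
in the plane is connected. -/
lemma exists_weierstrassZeta_add_coe (l : L.lattice) :
    ∃ η : ℂ, ∀ z ∉ L.lattice, weierstrassZeta L (z + l) = weierstrassZeta L z + η := by
  have hd (z : ℂ) (hz : z ∉ L.lattice) :
      HasDerivAt (fun z ↦ weierstrassZeta L (z + l) - weierstrassZeta L z) 0 z := by
    have h1 := (hasDerivAt_weierstrassZeta L (notMem_add_coe L hz l)).comp_add_const z (l : ℂ)
    refine (h1.fun_sub (hasDerivAt_weierstrassZeta L hz)).congr_deriv ?_
    simp
  have hconn : IsPreconnected ((L.lattice : Set ℂ)ᶜ) :=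
    (Set.Countable.isConnected_compl_of_one_lt_rank (by simp)
      (countable_of_Lindelof_of_discrete (X := L.lattice))).2
  obtain ⟨η, hη⟩ := L.isClosed_lattice.isOpen_compl.exists_is_const_of_deriv_eq_zero hconn
    (fun z hz ↦ (hd z hz).differentiableAt.differentiableWithinAt)
    (fun z hz ↦ (hd z hz).deriv)
  exact ⟨η, fun z hz ↦ by rw [← hη z hz]; ring⟩

/-! ### The Frobenius–Stickelberger relation -/

noncomputable section

open Classical in
/-- The difference of the two sides of the Frobenius–Stickelberger relation, as a function of the
first argument. -/
def stickelberger (b a : ℂ) : ℂ :=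
  if a ∈ L.lattice ∨ a + b ∈ L.lattice then 0 else
    (weierstrassZeta L a + weierstrassZeta L b - weierstrassZeta L (a + b)) ^ 2 -
      L.weierstrassP a - L.weierstrassP b - L.weierstrassP (a + b)

end

lemma stickelberger_of_mem {b a : ℂ} (h : a ∈ L.lattice ∨ a + b ∈ L.lattice) :
    stickelberger L b a = 0 := if_pos h

lemma stickelberger_of_notMem {b a : ℂ} (ha : a ∉ L.lattice) (hab : a + b ∉ L.lattice) :
    stickelberger L b a =
      (weierstrassZeta L a + weierstrassZeta L b - weierstrassZeta L (a + b)) ^ 2 -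
        L.weierstrassP a - L.weierstrassP b - L.weierstrassP (a + b) :=
  if_neg (not_or.mpr ⟨ha, hab⟩)

lemma stickelberger_add_coe (b a : ℂ) (l : L.lattice) :
    stickelberger L b (a + l) = stickelberger L b a := by
  have h (x : ℂ) : x + l ∈ L.lattice ↔ x ∈ L.lattice :=
    L.lattice.toAddSubgroup.add_mem_cancel_right (y := x) l.2
  by_cases hab : a ∈ L.lattice ∨ a + b ∈ L.lattice
  · rw [stickelberger_of_mem L hab, stickelberger_of_mem]
    rwa [add_right_comm, h, h]
  · obtain ⟨ha, hab⟩ := not_or.mp hab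
    obtain ⟨η, hη⟩ := exists_weierstrassZeta_add_coe L l
    rw [stickelberger_of_notMem L ha hab, stickelberger_of_notMem L (by rwa [h])
      (by rwa [add_right_comm, h]), add_right_comm, hη _ ha, hη _ hab,
      L.weierstrassP_add_coe, L.weierstrassP_add_coe]
    ring

/-- This reflection exchanges the singular classes a ∈ Λ and a ∈ -b + Λ, so only one of them needs a
local expansion. -/
lemma stickelberger_symm (b a : ℂ) : stickelberger L b (-b - a) = stickelberger L b a := by
  have h1 : -b - a = -(a + b) := by ring
  have h2 : -b - a + b = -a := by ring
  by_cases hab : a ∈ L.lattice ∨ a + b ∈ L.lattice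
  · rw [stickelberger_of_mem L hab, stickelberger_of_mem]
    rwa [h2, h1, neg_mem_iff, neg_mem_iff, or_comm]
  · obtain ⟨ha, hab⟩ := not_or.mp hab
    rw [stickelberger_of_notMem L ha hab, stickelberger_of_notMem L
      (by rwa [h1, neg_mem_iff]) (by rwa [h2, neg_mem_iff]), h2, h1]
    simp only [weierstrassZeta_neg, L.weierstrassP_neg]
    ring

lemma analyticAt_weierstrassZeta {z : ℂ} (hz : z ∉ L.lattice) :
    AnalyticAt ℂ (weierstrassZeta L) z :=
  DifferentiableOn.analyticAt (s := (L.lattice : Set ℂ)ᶜ)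
    (fun _ hx ↦ (hasDerivAt_weierstrassZeta L hx).differentiableAt.differentiableWithinAt)
    (L.isClosed_lattice.isOpen_compl.mem_nhds hz)

lemma analyticAt_zetaRegular_zero : AnalyticAt ℂ (zetaRegular L) 0 :=
  (differentiableOn_zetaRegular L).analyticAt
    ((isOpen_compl_lattice_sdiff_zero L).mem_nhds (by simp))

lemma stickelberger_zero (b : ℂ) : stickelberger L b 0 = 0 :=
  stickelberger_of_mem L (.inl (zero_mem _))

lemma analyticAt_dslope {f : ℂ → ℂ} {a : ℂ} (hf : AnalyticAt ℂ f a) :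
    AnalyticAt ℂ (dslope f a) a := by
  obtain ⟨p, hp⟩ := hf
  exact ⟨_, hp.has_fpower_series_dslope_fslope⟩

/-- Write the bracket as 1/a + D with D(0) = 0. The 1/a² of its square cancels the pole of ℘(a), and
2D/a is regular. Since D'(0) = ℘(b), the regularized value at 0 is 2℘(b) - ℘(b) - ℘(b) = 0, matching
the default value in `stickelberger`. -/
lemma analyticAt_stickelberger_zero {b : ℂ} (hb : b ∉ L.lattice) :
    AnalyticAt ℂ (stickelberger L b) 0 := by
  set D : ℂ → ℂ := fun a ↦ zetaRegular L a + weierstrassZeta L b - weierstrassZeta L (a + b)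
  have hb0 : (0 : ℂ) + b ∉ L.lattice := by simpa using hb
  have hζ : AnalyticAt ℂ (fun a ↦ weierstrassZeta L (a + b)) 0 :=
    (analyticAt_weierstrassZeta L hb0).comp (f := fun a : ℂ ↦ a + b) (by fun_prop)
  have h℘ : AnalyticAt ℂ (fun a ↦ L.weierstrassP (a + b)) 0 :=
    (L.analyticOnNhd_weierstrassP _ hb0).comp (f := fun a : ℂ ↦ a + b) (by fun_prop)
  have hD : AnalyticAt ℂ D 0 := by
    have := analyticAt_zetaRegular_zero L
    fun_prop
  have hD0 : D 0 = 0 := by simp [D, zetaRegular_zero]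
  have hD' : deriv D 0 = L.weierstrassP b := by
    have h1 := (analyticAt_zetaRegular_zero L).differentiableAt.hasDerivAt
    rw [deriv_zetaRegular L (by simp)] at h1
    have h2 := (hasDerivAt_weierstrassZeta L hb0).comp_add_const 0 b
    have h3 := (h1.add_const (weierstrassZeta L b)).fun_sub h2
    rw [h3.deriv]
    simp
  have hP := L.analyticAt_weierstrassPExcept 0
  have hS := analyticAt_dslope hD
  have hG : AnalyticAt ℂ (fun a ↦ 2 * dslope D 0 a + D a ^ 2 - L.weierstrassPExcept 0 a -
      L.weierstrassP b - L.weierstrassP (a + b)) 0 := by fun_prop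
  refine hG.congr ?_
  have hopen : ∀ᶠ a in 𝓝 (0 : ℂ), a + b ∉ L.lattice :=
    (by fun_prop : Continuous fun a : ℂ ↦ a + b).continuousAt.eventually
      (L.isClosed_lattice.isOpen_compl.mem_nhds hb0)
  filter_upwards [L.compl_lattice_sdiff_singleton_mem_nhds 0, hopen] with a ha hab
  by_cases ha0 : a = 0
  · subst ha0
    rw [stickelberger_zero, dslope_same, hD', hD0]
    simp
    ring
  · have hal : a ∉ L.lattice := by simp_all
    have h1 := L.weierstrassPExcept_add 0 a
    simp only [ZeroMemClass.coe_zero, sub_zero] at h1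
    rw [stickelberger_of_notMem L hal hab, dslope_of_ne _ ha0, slope_def_field, hD0,
      ← h1, weierstrassZeta_eq L a]
    simp only [D]
    field_simp
    ring

lemma analyticAt_stickelberger {b : ℂ} (hb : b ∉ L.lattice) (a : ℂ) :
    AnalyticAt ℂ (stickelberger L b) a := by
  have key (a : ℂ) (ha : a ∈ L.lattice) : AnalyticAt ℂ (stickelberger L b) a := by
    lift a to L.lattice using ha
    have := analyticAt_stickelberger_zero L hb
    rw [← sub_self a.1] at this
    convert! this.comp (f := (· - a.1)) (by fun_prop) using 1
    ext z
    rw [Function.comp_apply, ← stickelberger_add_coe L b (z - a) a, sub_add_cancel]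
  by_cases ha : a ∈ L.lattice
  · exact key a ha
  by_cases hab : a + b ∈ L.lattice
  · have hm : -b - a ∈ L.lattice := by
      rw [show -b - a = -(a + b) by ring]
      exact neg_mem hab
    convert! (key _ hm).comp (f := fun z ↦ -b - z) (by fun_prop) using 1
    ext z
    rw [Function.comp_apply, stickelberger_symm]
  · have hζ : AnalyticAt ℂ (fun a ↦ weierstrassZeta L (a + b)) a :=
      (analyticAt_weierstrassZeta L hab).comp (f := fun a : ℂ ↦ a + b) (by fun_prop)
    have h℘ : AnalyticAt ℂ (fun a ↦ L.weierstrassP (a + b)) a :=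
      (L.analyticOnNhd_weierstrassP _ hab).comp (f := fun a : ℂ ↦ a + b) (by fun_prop)
    have hζ1 := analyticAt_weierstrassZeta L ha
    have h℘1 := L.analyticOnNhd_weierstrassP _ ha
    have hG : AnalyticAt ℂ (fun a ↦
        (weierstrassZeta L a + weierstrassZeta L b - weierstrassZeta L (a + b)) ^ 2 -
          L.weierstrassP a - L.weierstrassP b - L.weierstrassP (a + b)) a := by fun_prop
    refine hG.congr ?_
    have hopen : ∀ᶠ z in 𝓝 a, z + b ∉ L.lattice :=
      (by fun_prop : Continuous fun a : ℂ ↦ a + b).continuousAt.eventually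
        (L.isClosed_lattice.isOpen_compl.mem_nhds hab)
    filter_upwards [L.isClosed_lattice.isOpen_compl.mem_nhds ha, hopen] with z hz hzb
    rw [stickelberger_of_notMem L hz hzb]

/-- The Frobenius–Stickelberger relation. -/
theorem frobenius_stickelberger {a b : ℂ} (ha : a ∉ L.lattice) (hb : b ∉ L.lattice)
    (hab : a + b ∉ L.lattice) :
    (weierstrassZeta L a + weierstrassZeta L b - weierstrassZeta L (a + b)) ^ 2 =
      L.weierstrassP a + L.weierstrassP b + L.weierstrassP (a + b) := by
  have hd : Differentiable ℂ (stickelberger L b) :=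
    fun x ↦ (analyticAt_stickelberger L hb x).differentiableAt
  -- Liouville: an entire function periodic under a lattice is bounded, hence equal to its value 0
  -- at the origin.
  have h := hd.apply_eq_apply_of_bounded (IsZLattice.isCompact_range_of_periodic L.lattice _
    hd.continuous fun z w hw ↦ by
      lift w to L.lattice using hw
      exact stickelberger_add_coe L b z w).isBounded a 0
  rw [stickelberger_zero, stickelberger_of_notMem L ha hab] at h
  linear_combination h

/-! ### Signed sums and second-order expansions -/

section Algebra

variable {ι : Type*}

/-- Matrices `z`, `w` with the symmetries of `ζ_{ij}` and `℘_{ij}` that satisfy the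
Frobenius–Stickelberger relation. -/
structure IsStickelbergerPair (z w : ι → ι → ℂ) : Prop where
  skew : ∀ i j, z j i = -z i j
  symm : ∀ i j, w j i = w i j
  diag : ∀ i, w i i = 0
  sq_add : ∀ i j k, i ≠ j → j ≠ k → i ≠ k →
    (z i j + z j k + z k i) ^ 2 = w i j + w j k + w k i

lemma IsStickelbergerPair.diag_left {z w : ι → ι → ℂ} (h : IsStickelbergerPair z w) (i : ι) :
    z i i = 0 := by
  simpa [CharZero.eq_neg_self_iff] using h.skew i i

/-- By skewness the left side is minus the cross terms of the squared relation. The Kronecker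
corrections make the formula valid for coinciding indices too, so it can be summed over all triples.
-/
lemma IsStickelbergerPair.cyclic [DecidableEq ι] {z w : ι → ι → ℂ} (h : IsStickelbergerPair z w)
    (i j k : ι) :
    z i j * z i k + z j i * z j k + z k i * z k j =
      ((z i j ^ 2 - w i j) + (z j k ^ 2 - w j k) + (z k i ^ 2 - w k i)) / 2 +
      ((if i = j then w i k else 0) + (if j = k then w i j else 0) +
        (if k = i then w k j else 0)) := by
  have hij := h.skew i j
  have hjk := h.skew j k
  have hki := h.skew k i
  have wij := h.symm i j
  have wjk := h.symm j k
  have wki := h.symm k i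
  have di := h.diag i
  have dj := h.diag j
  have dk := h.diag k
  have zi := h.diag_left i
  have zj := h.diag_left j
  by_cases e1 : i = j
  · subst e1
    by_cases e2 : i = k
    · subst e2
      simp [zi, di]
    · rw [if_pos rfl, if_neg e2, if_neg (Ne.symm e2), zi, di, hki, wki]
      ring
  by_cases e2 : j = k
  · subst e2
    rw [if_neg e1, if_pos rfl, if_neg (Ne.symm e1), zj, dj, hij, wij]
    ring
  by_cases e3 : k = i
  · subst e3
    rw [if_neg e1, if_neg e2, if_pos rfl, zi, di, hjk, wjk]
    ring
  rw [if_neg e1, if_neg e2, if_neg e3, hij, hjk, hki]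
  linear_combination (-1 / 2) * h.sq_add i j k e1 e2 (Ne.symm e3)

variable [Fintype ι]

lemma sum_mul_sq_eq (s : ι → ℂ) (z : ι → ι → ℂ) :
    ∑ i, s i * (∑ j, s j * z i j) ^ 2 =
      ∑ i, ∑ j, ∑ k, s i * s j * s k * (z i j * z i k) := by
  refine Finset.sum_congr rfl fun i _ ↦ ?_
  rw [sq, Finset.sum_mul_sum, Finset.mul_sum]
  refine Finset.sum_congr rfl fun j _ ↦ ?_
  rw [Finset.mul_sum]
  exact Finset.sum_congr rfl fun k _ ↦ by ring

/-- For balanced signs `s`, `∑ s_i (∑_j s_j ζ_{ij})² = ∑ s_i ℘_i`. -/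
theorem IsStickelbergerPair.sum_signed_sq {z w : ι → ι → ℂ} (h : IsStickelbergerPair z w)
    {s : ι → ℂ} (hs : ∀ i, s i ^ 2 = 1) (hs0 : ∑ i, s i = 0) :
    ∑ i, s i * (∑ j, s j * z i j) ^ 2 = ∑ i, s i * ∑ j, w i j := by
  classical
  rw [sum_mul_sq_eq]
  set T := ∑ i, ∑ j, ∑ k, s i * s j * s k * (z i j * z i k) with hT
  set S := ∑ i, s i * ∑ j, w i j with hS
  have hT2 : ∑ i, ∑ j, ∑ k, s i * s j * s k * (z j i * z j k) = T := by
    rw [Finset.sum_comm, hT]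
    exact Finset.sum_congr rfl fun i _ ↦ Finset.sum_congr rfl fun j _ ↦
      Finset.sum_congr rfl fun k _ ↦ by ring
  have hT3 : ∑ i, ∑ j, ∑ k, s i * s j * s k * (z k i * z k j) = T := by
    rw [Finset.sum_congr rfl fun i _ ↦ Finset.sum_comm, Finset.sum_comm, hT]
    exact Finset.sum_congr rfl fun i _ ↦ Finset.sum_congr rfl fun j _ ↦
      Finset.sum_congr rfl fun k _ ↦ by ring
  -- A factor independent of one index is killed by the balanced sum over that index.
  have hG1 (g : ι → ι → ℂ) : ∑ i, ∑ j, ∑ k, s i * s j * s k * g i j = 0 := by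
    refine Finset.sum_eq_zero fun i _ ↦ Finset.sum_eq_zero fun j _ ↦ ?_
    rw [Finset.sum_congr rfl fun k _ ↦ show s i * s j * s k * g i j = s i * s j * g i j * s k by
      ring, ← Finset.mul_sum, hs0, mul_zero]
  have hG2 (g : ι → ι → ℂ) : ∑ i, ∑ j, ∑ k, s i * s j * s k * g j k = 0 := by
    rw [Finset.sum_congr rfl fun i _ ↦ Finset.sum_congr rfl fun j _ ↦ Finset.sum_congr rfl
      fun k _ ↦ show s i * s j * s k * g j k = s i * (s j * s k * g j k) by ring]
    simp only [← Finset.mul_sum]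
    rw [← Finset.sum_mul, hs0, zero_mul]
  have hG3 (g : ι → ι → ℂ) : ∑ i, ∑ j, ∑ k, s i * s j * s k * g k i = 0 := by
    rw [← hG1 fun i k ↦ g k i]
    refine Finset.sum_congr rfl fun i _ ↦ ?_
    rw [Finset.sum_comm]
    exact Finset.sum_congr rfl fun k _ ↦ Finset.sum_congr rfl fun j _ ↦ by ring
  have hS' : ∑ i, ∑ j, s i * w i j = S := by simp only [hS, Finset.mul_sum]
  have hS'' : ∑ i, ∑ j, s j * w i j = S := by
    rw [Finset.sum_comm, ← hS']
    exact Finset.sum_congr rfl fun i _ ↦ Finset.sum_congr rfl fun j _ ↦ by rw [h.symm i j]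
  -- Each Kronecker term collapses through s_i² = 1 to one copy of S; in total 3T = 3S.
  have hD1 : ∑ i, ∑ j, ∑ k, s i * s j * s k * (if i = j then w i k else 0) = S := by
    rw [← hS'']
    refine Finset.sum_congr rfl fun i _ ↦ ?_
    rw [Finset.sum_comm]
    refine Finset.sum_congr rfl fun k _ ↦ ?_
    simp only [mul_ite, mul_zero, Finset.sum_ite_eq, Finset.mem_univ, if_true]
    linear_combination s k * w i k * hs i
  have hD2 : ∑ i, ∑ j, ∑ k, s i * s j * s k * (if j = k then w i j else 0) = S := by
    rw [← hS']
    refine Finset.sum_congr rfl fun i _ ↦ Finset.sum_congr rfl fun j _ ↦ ?_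
    simp only [mul_ite, mul_zero, Finset.sum_ite_eq, Finset.mem_univ, if_true]
    linear_combination s i * w i j * hs j
  have hD3 : ∑ i, ∑ j, ∑ k, s i * s j * s k * (if k = i then w k j else 0) = S := by
    rw [← hS'']
    refine Finset.sum_congr rfl fun i _ ↦ Finset.sum_congr rfl fun j _ ↦ ?_
    simp only [mul_ite, mul_zero, Finset.sum_ite_eq', Finset.mem_univ, if_true]
    linear_combination s j * w i j * hs i
  have key : ∑ i, ∑ j, ∑ k, s i * s j * s k * (z i j * z i k) +
      ∑ i, ∑ j, ∑ k, s i * s j * s k * (z j i * z j k) +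
      ∑ i, ∑ j, ∑ k, s i * s j * s k * (z k i * z k j) =
      (∑ i, ∑ j, ∑ k, s i * s j * s k * ((z i j ^ 2 - w i j) / 2) +
      ∑ i, ∑ j, ∑ k, s i * s j * s k * ((z j k ^ 2 - w j k) / 2) +
      ∑ i, ∑ j, ∑ k, s i * s j * s k * ((z k i ^ 2 - w k i) / 2)) +
      (∑ i, ∑ j, ∑ k, s i * s j * s k * (if i = j then w i k else 0) +
      ∑ i, ∑ j, ∑ k, s i * s j * s k * (if j = k then w i j else 0) +
      ∑ i, ∑ j, ∑ k, s i * s j * s k * (if k = i then w k j else 0)) := by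
    simp only [← Finset.sum_add_distrib]
    refine Finset.sum_congr rfl fun i _ ↦ Finset.sum_congr rfl fun j _ ↦
      Finset.sum_congr rfl fun k _ ↦ ?_
    linear_combination s i * s j * s k * h.cyclic i j k
  rw [hT2, hT3, hD1, hD2, hD3, hG1 fun i j ↦ (z i j ^ 2 - w i j) / 2,
    hG2 fun j k ↦ (z j k ^ 2 - w j k) / 2, hG3 fun k i ↦ (z k i ^ 2 - w k i) / 2, ← hT] at key
  linear_combination key / 3

/-- The first-order terms of a signed branch add up to zero. -/
lemma IsStickelbergerPair.sum_linear {z w : ι → ι → ℂ} (h : IsStickelbergerPair z w)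
    (s : ι → ℂ) : ∑ i, s i * ∑ j, z i j * s j = 0 := by
  have h1 : ∑ i, s i * ∑ j, z i j * s j = -∑ i, s i * ∑ j, z i j * s j := by
    conv_lhs => simp only [Finset.mul_sum]
    rw [Finset.sum_comm, ← Finset.sum_neg_distrib]
    refine Finset.sum_congr rfl fun i _ ↦ ?_
    rw [Finset.mul_sum, ← Finset.sum_neg_distrib]
    refine Finset.sum_congr rfl fun j _ ↦ ?_
    rw [h.skew i j]
    ring
  exact CharZero.eq_neg_self_iff.mp h1

/-- The second-order terms of a signed branch add up to zero. -/
lemma IsStickelbergerPair.sum_quadratic {z w : ι → ι → ℂ} (h : IsStickelbergerPair z w)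
    {s : ι → ℂ} (hs : ∀ i, s i ^ 2 = 1) (hs0 : ∑ i, s i = 0) {a : ι → ℂ}
    (ha : ∀ i, a i = s i / 2 * ∑ j, z i j * s j) :
    ∑ i, s i / 2 * (∑ j, z i j * a j + 3 / 4 * ∑ j, w i j - a i ^ 2) = 0 := by
  have hS := h.sum_signed_sq hs hs0
  set Z : ι → ℂ := fun i ↦ ∑ j, s j * z i j with hZ
  have ha' (i : ι) : a i = s i / 2 * Z i := by
    rw [ha]
    simp only [hZ, mul_comm (z i _)]
  have h1 : ∑ i, s i * ∑ j, z i j * a j = -∑ i, s i / 2 * Z i ^ 2 := by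
    simp only [Finset.mul_sum]
    rw [Finset.sum_comm, ← Finset.sum_neg_distrib]
    refine Finset.sum_congr rfl fun j _ ↦ ?_
    rw [sq, ← mul_assoc, ← ha' j]
    simp only [hZ, Finset.mul_sum]
    rw [← Finset.sum_neg_distrib]
    refine Finset.sum_congr rfl fun i _ ↦ ?_
    rw [h.skew j i]
    ring
  have h2 : ∑ i, s i / 2 * (∑ j, z i j * a j + 3 / 4 * ∑ j, w i j - a i ^ 2) =
      1 / 2 * ∑ i, s i * ∑ j, z i j * a j + 3 / 8 * ∑ i, s i * ∑ j, w i j -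
        1 / 8 * ∑ i, s i * Z i ^ 2 := by
    rw [Finset.mul_sum, Finset.mul_sum, Finset.mul_sum, ← Finset.sum_add_distrib,
      ← Finset.sum_sub_distrib]
    refine Finset.sum_congr rfl fun i _ ↦ ?_
    rw [ha' i]
    linear_combination (-s i / 8 * Z i ^ 2) * hs i
  have h3 : ∑ i, s i / 2 * Z i ^ 2 = 1 / 2 * ∑ i, s i * Z i ^ 2 := by
    rw [Finset.mul_sum]
    exact Finset.sum_congr rfl fun i _ ↦ by ring
  -- The coefficients cancel as -1/4 + 3/8 - 1/8 = 0; this is where the constant 3/4 is needed.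
  rw [h2, h1, h3, ← hS]
  ring

/-- If `z_i → s_i` along `l` solve the blown-up equations
`z_i² = 1 + τ ∑_j ζ_{ij} z_j + (3/4) ℘_i τ²` with `τ → 0`, then `∑ z_i = o(τ²)`. -/
theorem IsStickelbergerPair.tendsto_sum_div_sq {Z W : ι → ι → ℂ} (h : IsStickelbergerPair Z W)
    {s : ι → ℂ} (hs : ∀ i, s i ^ 2 = 1) (hs0 : ∑ i, s i = 0) {α : Type*} {l : Filter α}
    {τ : α → ℂ} (hτ : Tendsto τ l (𝓝 0)) (hτ0 : ∀ᶠ t in l, τ t ≠ 0) {z : ι → α → ℂ}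
    (hz : ∀ i, Tendsto (z i) l (𝓝 (s i)))
    (heq : ∀ᶠ t in l, ∀ i, z i t ^ 2 =
      1 + τ t * ∑ j, Z i j * z j t + 3 / 4 * (∑ j, W i j) * τ t ^ 2) :
    Tendsto (fun t ↦ (∑ i, z i t) / τ t ^ 2) l (𝓝 0) := by
  have hsne (i : ι) : s i ≠ 0 := fun e ↦ by simpa [e] using hs i
  have hsi (i : ι) : (2 * s i)⁻¹ = s i / 2 := by
    rw [inv_eq_iff_eq_inv, inv_div, div_eq_mul_inv, ← one_mul (s i)⁻¹, ← hs i]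
    field_simp [hsne i]
  -- The Taylor coefficients a and b arise as limits of successive difference quotients u and v, so
  -- convergence of z suffices. For u, divide z² - s² = (z - s)(z + s) by z + s → 2s.
  set a : ι → ℂ := fun i ↦ s i / 2 * ∑ j, Z i j * s j with ha
  set u : ι → α → ℂ := fun i t ↦ (z i t - s i) / τ t with hu
  have hu_lim (i : ι) : Tendsto (u i) l (𝓝 (a i)) := by
    have hnum : Tendsto (fun t ↦ ∑ j, Z i j * z j t + 3 / 4 * (∑ j, W i j) * τ t) l
        (𝓝 (∑ j, Z i j * s j)) := by
      have h1 := (tendsto_finsetSum Finset.univ fun j _ ↦ (hz j).const_mul (Z i j)).add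
        (hτ.const_mul (3 / 4 * ∑ j, W i j))
      simpa using h1
    have hden : Tendsto (fun t ↦ z i t + s i) l (𝓝 (2 * s i)) := by
      rw [two_mul]
      exact (hz i).add_const (s i)
    have h2s : 2 * s i ≠ 0 := mul_ne_zero two_ne_zero (hsne i)
    have h1 := hnum.div hden h2s
    rw [div_eq_mul_inv (∑ j, Z i j * s j), hsi i, mul_comm (∑ j, Z i j * s j)] at h1
    refine h1.congr' ?_
    filter_upwards [heq, hτ0, hden.eventually_ne h2s] with t ht htau hne
    simp only [hu, Pi.div_apply]
    rw [div_eq_div_iff hne htau]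
    linear_combination ht i * (-1) + hs i
  set b : ι → ℂ := fun i ↦ s i / 2 * (∑ j, Z i j * a j + 3 / 4 * ∑ j, W i j - a i ^ 2) with hb
  set v : ι → α → ℂ := fun i t ↦ (u i t - a i) / τ t with hv
  have hv_lim (i : ι) : Tendsto (v i) l (𝓝 (b i)) := by
    have h1 : Tendsto (fun t ↦ s i / 2 * (∑ j, Z i j * u j t + 3 / 4 * ∑ j, W i j - u i t ^ 2)) l
        (𝓝 (b i)) :=
      (((tendsto_finsetSum Finset.univ fun j _ ↦ (hu_lim j).const_mul (Z i j)).add_const _).sub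
        ((hu_lim i).pow 2)).const_mul _
    refine h1.congr' ?_
    filter_upwards [heq, hτ0] with t ht htau
    have hzu (j : ι) : z j t = s j + τ t * u j t := by
      simp only [hu]
      field_simp
      ring
    have hsum : ∑ j, Z i j * z j t = ∑ j, Z i j * s j + τ t * ∑ j, Z i j * u j t := by
      rw [Finset.mul_sum, ← Finset.sum_add_distrib]
      exact Finset.sum_congr rfl fun j _ ↦ by rw [hzu j]; ring
    have h2 := ht i
    rw [hsum, hzu i] at h2
    -- The equation with s_i² = 1 removed and one factor τ cancelled; its τ-free part determines
    -- a_i, the rest determines v.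
    have h3 : 2 * s i * u i t + τ t * u i t ^ 2 = ∑ j, Z i j * s j + τ t * ∑ j, Z i j * u j t +
        3 / 4 * (∑ j, W i j) * τ t := by
      refine mul_left_cancel₀ htau ?_
      linear_combination h2 - hs i
    simp only [hv, ha]
    rw [eq_div_iff htau]
    linear_combination (-s i / 2) * h3 + (u i t) * hs i
  have hsumb : ∑ i, b i = 0 := h.sum_quadratic hs hs0 fun i ↦ rfl
  have hsuma : ∑ i, a i = 0 := by
    have := h.sum_linear s
    simp only [ha, div_mul_eq_mul_div, ← Finset.sum_div]
    rw [this, zero_div]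
  rw [← hsumb]
  refine (tendsto_finsetSum Finset.univ fun i _ ↦ hv_lim i).congr' ?_
  filter_upwards [hτ0] with t htau
  simp only [hv, hu, ← Finset.sum_div, Finset.sum_sub_distrib, hsuma, hs0, sub_zero]
  rw [div_div, sq]

end Algebra

/-! ### Combinatorics of sign vectors -/

section Signs

lemma sum_neg_one_pow_label (n : ℕ) : ∑ i : Fin (2 * n), (-1 : ℂ) ^ label i = 0 := by
  simp only [label]
  rw [Fin.sum_univ_eq_sum_range fun k ↦ (-1 : ℂ) ^ (k + 1)]
  induction n with
  | zero => simp
  | succ n ih =>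
    rw [show 2 * (n + 1) = 2 * n + 1 + 1 by ring, Finset.sum_range_succ, Finset.sum_range_succ, ih]
    ring

/-- Each unordered pair contributes (-1)^i + (-1)^j, which is 2, -2 or 0 according to the parities.
-/
lemma sum_label_sign_eq {m : ℕ} (w : Fin m → Fin m → ℂ) (hw : ∀ i j, w j i = w i j)
    (hw0 : ∀ i, w i i = 0) :
    ∑ i, (-1) ^ label i * ∑ j, w i j =
      2 * ((∑ i, ∑ j with i < j ∧ Even (label i) ∧ Even (label j), w i j) -
        ∑ i, ∑ j with i < j ∧ Odd (label i) ∧ Odd (label j), w i j) := by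
  have h1 : ∑ i, (-1) ^ label i * ∑ j, w i j =
      ∑ i, ∑ j, (if i < j then (-1) ^ label i * w i j else 0) +
      ∑ i, ∑ j, (if j < i then (-1) ^ label i * w i j else 0) := by
    simp only [← Finset.sum_add_distrib, Finset.mul_sum]
    refine Finset.sum_congr rfl fun i _ ↦ Finset.sum_congr rfl fun j _ ↦ ?_
    rcases lt_trichotomy i j with h | rfl | h
    · simp [h, h.not_gt]
    · simp [hw0]
    · simp [h, h.not_gt]
  rw [h1, Finset.sum_comm (f := fun i j ↦ if j < i then (-1) ^ label i * w i j else 0)]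
  simp only [Finset.sum_filter]
  rw [← Finset.sum_add_distrib, ← Finset.sum_sub_distrib, Finset.mul_sum]
  refine Finset.sum_congr rfl fun i _ ↦ ?_
  rw [← Finset.sum_add_distrib, ← Finset.sum_sub_distrib, Finset.mul_sum]
  refine Finset.sum_congr rfl fun j _ ↦ ?_
  by_cases hij : i < j
  · rw [hw i j]
    rcases Nat.even_or_odd (label i) with hi | hi <;> rcases Nat.even_or_odd (label j) with hj | hj
    · simp [hij, hi, hj, hi.neg_one_pow, hj.neg_one_pow, Nat.not_odd_iff_even.mpr hi]
      ring
    · simp [hij, hi, hj, hi.neg_one_pow, hj.neg_one_pow, Nat.not_odd_iff_even.mpr hi,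
        Nat.not_even_iff_odd.mpr hj]
    · simp [hij, hi, hj, hi.neg_one_pow, hj.neg_one_pow, Nat.not_odd_iff_even.mpr hj,
        Nat.not_even_iff_odd.mpr hi]
    · simp [hij, hi, hj, hi.neg_one_pow, hj.neg_one_pow, Nat.not_even_iff_odd.mpr hi]
      ring
  · simp [hij]

/-- A sign vector corresponds to the set S where it is +1; its sum is 2|S| - 2n, zero exactly when
|S| = n. -/
lemma card_balanced_signs (n : ℕ) :
    (Finset.univ.filter fun ε : Fin (2 * n) → ℤˣ => ∑ i, (ε i : ℤ) = 0).card =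
      (2 * n).choose n := by
  have hsum (S : Finset (Fin (2 * n))) :
      ∑ i, (if i ∈ S then (1 : ℤ) else -1) = 2 * S.card - 2 * n := by
    have h1 (i : Fin (2 * n)) : (if i ∈ S then (1 : ℤ) else -1) =
        2 * (if i ∈ S then 1 else 0) - 1 := by split_ifs <;> norm_num
    simp only [h1, Finset.sum_sub_distrib, ← Finset.mul_sum]
    simp
  have hε (ε : Fin (2 * n) → ℤˣ) (i : Fin (2 * n)) :
      (ε i : ℤ) = if i ∈ Finset.univ.filter (fun i ↦ ε i = 1) then (1 : ℤ) else -1 := by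
    rcases Int.units_eq_one_or (ε i) with h | h <;> simp [h]
  have hcard : (Finset.powersetCard n (Finset.univ : Finset (Fin (2 * n)))).card =
      (2 * n).choose n := by simp
  rw [← hcard]
  refine Finset.card_nbij' (fun ε ↦ Finset.univ.filter fun i ↦ ε i = 1)
    (fun S i ↦ if i ∈ S then 1 else -1) ?_ ?_ ?_ ?_
  · intro ε he
    simp only [Finset.coe_filter, Finset.mem_univ, true_and, Set.mem_ofPred_eq] at he
    rw [Finset.sum_congr rfl fun i _ ↦ hε ε i, hsum] at he
    simp only [Finset.mem_coe, Finset.mem_powersetCard, Finset.subset_univ, true_and]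
    omega
  · intro S hS
    simp only [Finset.mem_coe, Finset.mem_powersetCard, Finset.subset_univ, true_and] at hS
    simp only [Finset.coe_filter, Finset.mem_univ, true_and, Set.mem_ofPred_eq]
    rw [Finset.sum_congr rfl fun i _ ↦ show (((if i ∈ S then 1 else -1 : ℤˣ) : ℤˣ) : ℤ) =
      if i ∈ S then 1 else -1 by split_ifs <;> rfl, hsum, hS]
    ring
  · intro ε _
    ext i
    rcases Int.units_eq_one_or (ε i) with h | h <;> simp [h]
  · intro S _
    ext i
    by_cases h : i ∈ S <;> simp [h]

end Signs

/-! ### From lattice functions to the algebraic relations -/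

section Lattice

lemma sub_notMem_lattice {ι : Type*} {p : ι → ℂ}
    (hp : Function.Injective fun i => L.lattice.mkQ (p i)) {i j : ι} (hij : i ≠ j) :
    p i - p j ∉ L.lattice := fun h ↦
  hij (hp ((Submodule.Quotient.eq L.lattice).mpr h))

theorem isStickelbergerPair {m : ℕ} {p : Fin m → ℂ}
    (hp : Function.Injective fun i => L.lattice.mkQ (p i)) :
    IsStickelbergerPair (zetaC L p) (wpC L p) where
  skew i j := by
    by_cases h : i = j
    · simp [zetaC, h]
    · simp only [zetaC, h, Ne.symm h, if_false]
      rw [← weierstrassZeta_neg, neg_sub]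
  symm i j := by
    by_cases h : i = j
    · simp [h]
    · simp only [wpC, h, Ne.symm h, if_false]
      rw [← L.weierstrassP_neg, neg_sub]
  diag i := by simp [wpC]
  sq_add i j k hij hjk hik := by
    have h := frobenius_stickelberger L (sub_notMem_lattice L hp hij) (sub_notMem_lattice L hp hjk)
      (by simpa using sub_notMem_lattice L hp hik)
    rw [sub_add_sub_cancel] at h
    simp only [zetaC, wpC, hij, hjk, hik.symm, if_false]
    rw [← neg_sub (p i) (p k), weierstrassZeta_neg, L.weierstrassP_neg, ← h]
    ring

end Lattice

/-! ### Germs tangent to the hyperplane -/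

open scoped ContDiff

lemma globalForm_apply (m : ℕ) (x : Fin (m + 1) → ℂ) : globalForm m x = ∑ i : Fin m, x i.succ := by
  simp [globalForm, LinearMap.sum_apply]

/-- If the order n were at most 3, multiplying f/t³ by t^(3-n) would recover the nonvanishing
leading factor, yet tend to 0. -/
lemma four_le_analyticOrderAt {f : ℂ → ℂ} (hf : AnalyticAt ℂ f 0)
    (h : Tendsto (fun t ↦ f t / t ^ 3) (𝓝[≠] 0) (𝓝 0)) : 4 ≤ analyticOrderAt f 0 := by
  by_contra hlt
  rw [not_le] at hlt
  obtain ⟨n, hn⟩ := ENat.ne_top_iff_exists.mp hlt.ne_top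
  rw [← hn] at hlt
  have hn3 : n ≤ 3 := by
    have : n < 4 := by exact_mod_cast hlt
    omega
  obtain ⟨g, hg, hg0, hfg⟩ := hf.analyticOrderAt_eq_natCast.mp hn.symm
  refine hg0 (tendsto_nhds_unique (l := 𝓝[≠] (0 : ℂ))
    (hg.continuousAt.tendsto.mono_left nhdsWithin_le_nhds) ?_)
  have hpow : Tendsto (fun t : ℂ ↦ t ^ (3 - n)) (𝓝[≠] 0) (𝓝 (0 ^ (3 - n))) :=
    ((continuous_pow (3 - n)).tendsto 0).mono_left nhdsWithin_le_nhds
  have h1 := h.mul hpow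
  rw [zero_mul] at h1
  refine h1.congr' ?_
  filter_upwards [nhdsWithin_le_nhds hfg, self_mem_nhdsWithin] with t ht ht0
  have ht0 : t ≠ 0 := ht0
  rw [ht, sub_zero, smul_eq_mul, div_mul_eq_mul_div, div_eq_iff (pow_ne_zero _ ht0)]
  rw [mul_assoc, mul_comm (g t), ← mul_assoc, ← pow_add, Nat.add_sub_cancel' hn3]
  ring

variable {m : ℕ} {p : Fin m → ℂ}

/-- A curve germ of `C` at the origin with tangent line in `H` meets `H` with multiplicity at
least four. -/
theorem four_le_intersectionMult (h : IsStickelbergerPair (zetaC L p) (wpC L p)) (hm : 0 < m)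
    {γ : ℂ → Fin (m + 1) → ℂ} {v : Fin (m + 1) → ℂ} (hγ : IsCurveGerm (curveC L p) 0 γ)
    (hv : IsTangentVector γ v) (hvH : v ∈ globalConstraint m) : 4 ≤ intersectionMult γ := by
  obtain ⟨hv0, k, hk, g, hg, rfl, hγg⟩ := hv
  have hgc (j : Fin (m + 1)) : Tendsto (fun t ↦ g t j) (𝓝[≠] 0) (𝓝 (g 0 j)) :=
    (((continuous_apply j).continuousAt.comp hg.continuousAt).tendsto).mono_left
      nhdsWithin_le_nhds
  have hid : Tendsto (fun t : ℂ ↦ t) (𝓝[≠] 0) (𝓝 0) := tendsto_id.mono_left nhdsWithin_le_nhds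
  have hpow : Tendsto (fun t : ℂ ↦ t ^ k) (𝓝[≠] 0) (𝓝 0) := by
    simpa [hk.ne'] using hid.pow k
  have hγt : ∀ᶠ t in 𝓝[≠] (0 : ℂ), ∀ j, γ t j = t ^ k * g t j := by
    filter_upwards [nhdsWithin_le_nhds hγg] with t ht j
    rw [ht, hγ.map_zero]
    simp
  set B : Fin m → ℂ → ℂ := fun i t ↦
    ∑ j, zetaC L p i j * g t j.succ + 3 / 4 * wpSum L p i * g t 0 with hB
  have heq : ∀ᶠ t in 𝓝[≠] (0 : ℂ), ∀ i : Fin m,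
      t ^ k * g t i.succ ^ 2 = g t 0 * (1 + t ^ k * B i t) := by
    filter_upwards [nhdsWithin_le_nhds hγ.mem, hγt, self_mem_nhdsWithin] with t ht hgt ht0 i
    have hq := ht i
    have htk : t ^ k ≠ 0 := pow_ne_zero _ ht0
    simp only [quadric, hgt] at hq
    have hs : ∑ j, zetaC L p i j * (t ^ k * g t j.succ) =
        t ^ k * ∑ j, zetaC L p i j * g t j.succ := by
      rw [Finset.mul_sum]
      exact Finset.sum_congr rfl fun j _ ↦ by ring
    rw [hs] at hq
    refine mul_left_cancel₀ htk ?_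
    simp only [hB]
    linear_combination hq
  have hden (i : Fin m) : Tendsto (fun t ↦ 1 + t ^ k * B i t) (𝓝[≠] 0) (𝓝 1) := by
    have hBi : Tendsto (B i) (𝓝[≠] 0)
        (𝓝 (∑ j, zetaC L p i j * g 0 j.succ + 3 / 4 * wpSum L p i * g 0 0)) :=
      (tendsto_finsetSum Finset.univ fun j _ ↦ (hgc j.succ).const_mul _).add
        ((hgc 0).const_mul _)
    simpa using (hpow.mul hBi).const_add 1
  -- The same quotient has limit g_i(0)² for every i: hence the tangent has zero x_0-component and
  -- all its other components have equal squares.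
  have hquot (i : Fin m) : Tendsto (fun t ↦ g t 0 / t ^ k) (𝓝[≠] 0) (𝓝 (g 0 i.succ ^ 2)) := by
    have h1 := ((hgc i.succ).pow 2).div (hden i) one_ne_zero
    rw [div_one] at h1
    refine h1.congr' ?_
    filter_upwards [heq, (hden i).eventually_ne one_ne_zero, self_mem_nhdsWithin] with t ht hne ht0
    have htk : t ^ k ≠ 0 := pow_ne_zero _ ht0
    simp only [Pi.div_apply]
    rw [div_eq_div_iff hne htk]
    linear_combination ht i
  have hg00 : g 0 0 = 0 := by
    have h1 := (hquot ⟨0, hm⟩).mul hpow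
    rw [mul_zero] at h1
    refine tendsto_nhds_unique (hgc 0) (h1.congr' ?_)
    filter_upwards [self_mem_nhdsWithin] with t ht0
    exact div_mul_cancel₀ _ (pow_ne_zero _ ht0)
  obtain ⟨i₀, hi₀⟩ : ∃ i : Fin m, g 0 i.succ ≠ 0 := by
    by_contra! hall
    refine hv0 (funext fun j ↦ ?_)
    refine Fin.cases hg00 (fun i ↦ hall i) j
  set c := g 0 i₀.succ with hc
  set s : Fin m → ℂ := fun i ↦ g 0 i.succ / c with hs
  have hs1 (i : Fin m) : s i ^ 2 = 1 := by
    simp only [hs, div_pow]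
    rw [tendsto_nhds_unique (hquot i) (hquot i₀), div_self (pow_ne_zero _ hi₀)]
  have hs0 : ∑ i, s i = 0 := by
    have : globalForm m (g 0) = 0 := hvH
    rw [globalForm_apply] at this
    simp only [hs, ← Finset.sum_div, this, zero_div]
  -- Dividing by c² makes the radicand tend to 1, where the principal square root is continuous.
  set ρ : ℂ → ℂ := fun t ↦ (g t 0 / t ^ k / c ^ 2) ^ (((2 : ℕ) : ℂ)⁻¹) with hρ
  have hρ2 (t : ℂ) : ρ t ^ 2 = g t 0 / t ^ k / c ^ 2 := Complex.cpow_nat_inv_pow _ two_ne_zero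
  have hρ1 : Tendsto ρ (𝓝[≠] 0) (𝓝 1) := by
    have h1 := (hquot i₀).div_const (c ^ 2)
    rw [← hc, div_self (pow_ne_zero _ hi₀)] at h1
    have h2 : ContinuousAt (fun x : ℂ ↦ x ^ (((2 : ℕ) : ℂ)⁻¹)) 1 :=
      continuousAt_cpow_const (by simp)
    have h3 := h2.tendsto.comp h1
    rwa [Complex.one_cpow] at h3
  set τ : ℂ → ℂ := fun t ↦ c * t ^ k * ρ t with hτ
  have hτ_lim : Tendsto τ (𝓝[≠] 0) (𝓝 0) := by
    simpa using (hpow.const_mul c).mul hρ1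
  have hτ_ne : ∀ᶠ t in 𝓝[≠] (0 : ℂ), τ t ≠ 0 := by
    filter_upwards [hρ1.eventually_ne one_ne_zero, self_mem_nhdsWithin] with t ht ht0
    exact mul_ne_zero (mul_ne_zero hi₀ (pow_ne_zero _ ht0)) ht
  have hτ2 : ∀ᶠ t in 𝓝[≠] (0 : ℂ), τ t ^ 2 = γ t 0 := by
    filter_upwards [hγt, self_mem_nhdsWithin] with t hgt ht0
    have htk : t ^ k ≠ 0 := pow_ne_zero _ ht0
    simp only [hτ, mul_pow, hρ2, hgt]
    field_simp
  have hz (i : Fin m) : Tendsto (fun t ↦ γ t i.succ / τ t) (𝓝[≠] 0) (𝓝 (s i)) := by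
    have h1 := (hgc i.succ).div (hρ1.const_mul c) (by simpa using hi₀)
    rw [mul_one] at h1
    refine h1.congr' ?_
    filter_upwards [hγt, self_mem_nhdsWithin] with t hgt ht0
    have htk : t ^ k ≠ 0 := pow_ne_zero _ ht0
    simp only [hτ, hgt, Pi.div_apply]
    rw [mul_comm c (t ^ k), mul_assoc, mul_div_mul_left _ _ htk]
  have hblow : ∀ᶠ t in 𝓝[≠] (0 : ℂ), ∀ i : Fin m, (γ t i.succ / τ t) ^ 2 =
      1 + τ t * ∑ j, zetaC L p i j * (γ t j.succ / τ t) +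
        3 / 4 * (∑ j, wpC L p i j) * τ t ^ 2 := by
    filter_upwards [nhdsWithin_le_nhds hγ.mem, hτ2, hτ_ne] with t ht h2 hne i
    have hq := ht i
    simp only [quadric, wpSum, ← h2] at hq
    simp only [mul_div_assoc', ← Finset.sum_div]
    field_simp
    linear_combination 4 * hq
  have key := h.tendsto_sum_div_sq hs1 hs0 hτ_lim hτ_ne hz hblow
  have han : AnalyticAt ℂ (fun t ↦ globalForm m (γ t)) 0 := by
    simp only [globalForm_apply]
    exact Finset.analyticAt_fun_sum _ fun i _ ↦ analyticAt_pi_iff.mp hγ.analyticAt i.succ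
  refine four_le_analyticOrderAt han ?_
  -- Only finiteness of the limit matters: it is c if k = 1 and 0 otherwise.
  have hratio : Tendsto (fun t ↦ τ t / t) (𝓝[≠] 0) (𝓝 (c * 0 ^ (k - 1) * 1)) := by
    refine (((hid.pow (k - 1)).const_mul c).mul hρ1).congr' ?_
    filter_upwards [self_mem_nhdsWithin] with t ht0
    have ht0 : t ≠ 0 := ht0
    rw [eq_div_iff ht0]
    simp only [hτ]
    rw [← pow_sub_one_mul hk.ne' t]
    ring
  have hfin := key.mul (hratio.pow 3)
  rw [zero_mul] at hfin
  refine hfin.congr' ?_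
  filter_upwards [hτ_ne, self_mem_nhdsWithin] with t hne ht0
  have ht0 : t ≠ 0 := ht0
  rw [globalForm_apply, ← Finset.sum_div]
  field_simp

/-! ### Existence and uniqueness of the signed branches -/

/-- The equations of `C` after the substitution `x_0 = t²`, `x_i = t z_i`, divided by `t²`. -/
noncomputable def blowup (p : Fin m → ℂ) (u : ℂ × (Fin m → ℂ)) (i : Fin m) : ℂ :=
  u.2 i ^ 2 - u.1 * ∑ j, zetaC L p i j * u.2 j - 1 - 3 / 4 * wpSum L p i * u.1 ^ 2

lemma quadric_cons (p : Fin m → ℂ) (t : ℂ) (z : Fin m → ℂ) (i : Fin m) :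
    quadric L p i (Fin.cons (t ^ 2) fun j ↦ t * z j : Fin (m + 1) → ℂ) =
      t ^ 2 * blowup L p (t, z) i := by
  simp only [quadric, blowup, Fin.cons_succ, Fin.cons_zero]
  have hs : ∑ j, zetaC L p i j * (t * z j) = t * ∑ j, zetaC L p i j * z j := by
    rw [Finset.mul_sum]
    exact Finset.sum_congr rfl fun j _ ↦ by ring
  rw [hs]
  ring

lemma contDiff_blowup (p : Fin m → ℂ) : ContDiff ℂ ω (blowup L p) := by
  unfold blowup
  fun_prop

/-- At t = 0 the equations decouple into z_i² = 1, so the Jacobian in z is diagonal with entries 2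
s_i. -/
lemma isInvertible_fderiv_blowup (p : Fin m → ℂ) {s : Fin m → ℂ} (hs : ∀ i, s i ≠ 0) :
    (fderiv ℂ (blowup L p) (0, s) ∘L .inr ℂ ℂ (Fin m → ℂ)).IsInvertible := by
  have hd : HasFDerivAt (fun z : Fin m → ℂ ↦ blowup L p (0, z))
      (fderiv ℂ (blowup L p) (0, s) ∘L .inr ℂ ℂ (Fin m → ℂ)) s := by
    have h1 : HasFDerivAt (blowup L p) (fderiv ℂ (blowup L p) (0, s)) (0, s) :=
      ((contDiff_blowup L p).differentiable (by simp)).differentiableAt.hasFDerivAt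
    exact h1.comp s (hasFDerivAt_prodMk_right 0 s)
  let e : (Fin m → ℂ) ≃L[ℂ] (Fin m → ℂ) := ContinuousLinearEquiv.piCongrRight fun i ↦
    ContinuousLinearEquiv.unitsEquivAut ℂ (Units.mk0 (2 * s i) (mul_ne_zero two_ne_zero (hs i)))
  have hd' : HasFDerivAt (fun z : Fin m → ℂ ↦ blowup L p (0, z))
      (e : (Fin m → ℂ) →L[ℂ] (Fin m → ℂ)) s := by
    rw [hasFDerivAt_pi']
    intro i
    have h1 : HasFDerivAt (fun z : Fin m → ℂ ↦ z i)
        (ContinuousLinearMap.proj (R := ℂ) (φ := fun _ : Fin m ↦ ℂ) i) s := hasFDerivAt_apply i s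
    have h2 := (h1.pow 2).sub_const 1
    simp only [blowup, zero_mul, sub_zero, ne_eq, OfNat.ofNat_ne_zero, not_false_eq_true, zero_pow,
      mul_zero]
    refine h2.congr_fderiv ?_
    ext z
    simp [e]
    ring
  exact ⟨e, hd'.unique hd⟩

/-- Near `(0, s)` the solutions of the blown-up equations form the graph of an analytic
function. -/
lemma exists_blowup_solution (p : Fin m → ℂ) {s : Fin m → ℂ} (hs : ∀ i, s i ^ 2 = 1) :
    ∃ ψ : ℂ → Fin m → ℂ, AnalyticAt ℂ ψ 0 ∧ ψ 0 = s ∧ (∀ᶠ t in 𝓝 0, blowup L p (t, ψ t) = 0) ∧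
      ∀ᶠ u in 𝓝 ((0 : ℂ), s), blowup L p u = 0 → ψ u.1 = u.2 := by
  have cdf : ContDiffAt ℂ ω (blowup L p) (0, s) := (contDiff_blowup L p).contDiffAt
  have hinv := isInvertible_fderiv_blowup L p (s := s) fun i e ↦ by simpa [e] using hs i
  have h0 : blowup L p (0, s) = 0 := by
    ext i
    simp [blowup, hs]
  have hω : (ω : WithTop ℕ∞) ≠ 0 := by simp
  refine ⟨cdf.implicitFunction hω hinv, (cdf.contDiffAt_implicitFunction hω hinv).analyticAt,
    cdf.implicitFunction_apply_self hω hinv, ?_, ?_⟩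
  · simpa only [h0] using cdf.eventually_apply_implicitFunction hω hinv
  · filter_upwards [cdf.eventually_apply_eq_iff_implicitFunction hω hinv] with u hu h
    exact hu.mp (h.trans h0.symm)

variable {ε : Fin m → ℤˣ}

lemma units_cast_sq (e : ℤˣ) : ((e : ℤ) : ℂ) ^ 2 = 1 := by
  rcases Int.units_eq_one_or e with h | h <;> simp [h]

theorem exists_unique_signedBranch (hp : IsStickelbergerPair (zetaC L p) (wpC L p)) (hm : 0 < m)
    (hε : ∑ i, (ε i : ℤ) = 0) :
    ∃ γ : ℂ → Fin (m + 1) → ℂ, IsSignedBranch L p ε γ ∧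
      (∀ γ' : ℂ → Fin (m + 1) → ℂ, IsSignedBranch L p ε γ' → γ' =ᶠ[𝓝 0] γ) ∧
      4 ≤ intersectionMult γ := by
  set s : Fin m → ℂ := fun i ↦ ((ε i : ℤ) : ℂ) with hs
  have hsne (i : Fin m) : s i ≠ 0 := fun e ↦ by
    have := units_cast_sq (ε i)
    simp_all
  obtain ⟨ψ, hψ, hψ0, hsol, huniq⟩ := exists_blowup_solution L p (s := s)
    fun i ↦ units_cast_sq (ε i)
  have hψi (i : Fin m) : AnalyticAt ℂ (fun t ↦ ψ t i) 0 := analyticAt_pi_iff.mp hψ i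
  set γ : ℂ → Fin (m + 1) → ℂ := fun t ↦ Fin.cons (t ^ 2) fun i ↦ t * ψ t i with hγ
  set g : ℂ → Fin (m + 1) → ℂ := fun t ↦ Fin.cons t (ψ t) with hg
  have hγa : AnalyticAt ℂ γ 0 := by
    refine analyticAt_pi_iff.mpr fun j ↦ ?_
    refine Fin.cases ?_ (fun i ↦ ?_) j
    · simp only [Fin.cons_zero]
      fun_prop
    · simp only [Fin.cons_succ]
      have := hψi i
      fun_prop
  have hga : AnalyticAt ℂ g 0 := by
    refine analyticAt_pi_iff.mpr fun j ↦ ?_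
    refine Fin.cases ?_ (fun i ↦ ?_) j
    · simp only [Fin.cons_zero]
      fun_prop
    · simp only [Fin.cons_succ]
      exact hψi i
  have hγ0 : γ 0 = 0 := by
    ext j
    refine Fin.cases ?_ (fun i ↦ ?_) j <;> simp [hγ]
  have hder (i : Fin m) : HasDerivAt (fun t ↦ γ t i.succ) (s i) 0 := by
    have h1 := (hasDerivAt_id (0 : ℂ)).fun_mul (hψi i).differentiableAt.hasDerivAt
    simp only [hγ, Fin.cons_succ]
    refine h1.congr_deriv ?_
    simp [hψ0]
  have hgerm : IsCurveGerm (curveC L p) 0 γ := by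
    refine ⟨hγa, hγ0, ?_, ?_⟩
    · filter_upwards [hsol] with t ht i
      rw [quadric_cons, ht, Pi.zero_apply, mul_zero]
    · set i₀ : Fin m := ⟨0, hm⟩
      -- One coordinate with nonzero derivative has a local inverse, which makes γ injective near 0.
      have h1 : HasStrictDerivAt (fun t ↦ γ t i₀.succ) (s i₀) 0 := by
        rw [← (hder i₀).deriv]
        exact (analyticAt_pi_iff.mp hγa i₀.succ).hasStrictDerivAt
      refine ⟨_, h1.eventually_left_inverse (hsne i₀), fun x hx y hy hxy ↦ ?_⟩
      have hx' : h1.localInverse _ _ _ (hsne i₀) (γ x i₀.succ) = x := hx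
      have hy' : h1.localInverse _ _ _ (hsne i₀) (γ y i₀.succ) = y := hy
      rw [← hx', hxy, hy']
  refine ⟨γ, ⟨hgerm, .of_forall fun t ↦ by simp [hγ], hder⟩, fun γ' hγ' ↦ ?_, ?_⟩
  · have hx (i : Fin m) : AnalyticAt ℂ (fun t ↦ γ' t i.succ) 0 :=
      analyticAt_pi_iff.mp hγ'.isCurveGerm.analyticAt i.succ
    -- The quotients x_i/t of a competing branch extend across 0 with value s, so they stay in the
    -- uniqueness neighbourhood of the implicit function theorem.
    set z : ℂ → Fin m → ℂ := fun t i ↦ dslope (fun t ↦ γ' t i.succ) 0 t with hz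
    have hz0 : z 0 = s := by
      ext i
      simp only [hz, dslope_same]
      exact (hγ'.hasDerivAt i).deriv
    have hzt (t : ℂ) (i : Fin m) : γ' t i.succ = t * z t i := by
      have h1 := sub_smul_dslope (fun t ↦ γ' t i.succ) 0 t
      simp only [hγ'.isCurveGerm.map_zero, Pi.zero_apply, sub_zero, smul_eq_mul] at h1
      exact h1.symm
    have hzc : ContinuousAt (fun t ↦ (t, z t)) 0 :=
      continuousAt_id.prodMk (continuousAt_pi.mpr fun i ↦
        (analyticAt_dslope (hx i)).continuousAt)
    have hev := hzc.eventually (by simpa only [hz0] using huniq)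
    have hγ'eq : ∀ᶠ t in 𝓝 (0 : ℂ), γ' t =
        (Fin.cons (t ^ 2) fun i ↦ t * z t i : Fin (m + 1) → ℂ) := by
      filter_upwards [hγ'.coord_zero] with t ht
      ext j
      refine Fin.cases ?_ (fun i ↦ ?_) j
      · simp [ht]
      · simp [hzt]
    filter_upwards [hev, hγ'eq, hγ'.isCurveGerm.mem] with t ht1 ht2 ht3
    rw [ht2]
    by_cases ht0 : t = 0
    · subst ht0
      simp [hγ]
    · have h1 : blowup L p (t, z t) = 0 := by
        ext i
        have h2 := ht3 i
        rw [ht2, quadric_cons] at h2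
        exact (mul_eq_zero.mp h2).resolve_left (pow_ne_zero _ ht0)
      simp only [hγ, ht1 h1]
  · refine four_le_intersectionMult L hp hm (v := g 0) hgerm ⟨?_, 1, one_pos, g, hga, rfl, ?_⟩ ?_
    · intro e
      have := congrFun e (Fin.succ ⟨0, hm⟩)
      simp only [hg, Fin.cons_succ, hψ0, Pi.zero_apply] at this
      exact hsne _ this
    · refine .of_forall fun t ↦ ?_
      rw [hγ0]
      ext j
      refine Fin.cases ?_ (fun i ↦ ?_) j
      · simp [hγ, hg, sq]
      · simp [hγ, hg]
    · change globalForm m (g 0) = 0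
      rw [globalForm_apply]
      simp only [hg, Fin.cons_succ, hψ0, hs]
      exact_mod_cast hε

end GenLame

/-! ### Assembly -/

theorem mainTheorem6 (L : PeriodPair) (n : ℕ) (hn : 1 ≤ n) (p : Fin (2 * n) → ℂ)
    (hp : Function.Injective fun i => L.lattice.mkQ (p i)) :
    (∑ i, (-1) ^ GenLame.label i * GenLame.wpSum L p i =
      2 * ((∑ i, ∑ j with i < j ∧ Even (GenLame.label i) ∧ Even (GenLame.label j),
              GenLame.wpC L p i j) -
           ∑ i, ∑ j with i < j ∧ Odd (GenLame.label i) ∧ Odd (GenLame.label j),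
              GenLame.wpC L p i j)) ∧
    (2 * ((∑ i, ∑ j with i < j ∧ Even (GenLame.label i) ∧ Even (GenLame.label j),
              GenLame.wpC L p i j) -
           ∑ i, ∑ j with i < j ∧ Odd (GenLame.label i) ∧ Odd (GenLame.label j),
              GenLame.wpC L p i j) =
      ∑ i, (-1) ^ GenLame.label i * GenLame.zetaHat L p i ^ 2) ∧
    (∀ (γ : ℂ → Fin (2 * n + 1) → ℂ) (v : Fin (2 * n + 1) → ℂ),
      GenLame.IsCurveGerm (GenLame.curveC L p) 0 γ → GenLame.IsTangentVector γ v →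
      v ∈ GenLame.globalConstraint (2 * n) → 4 ≤ GenLame.intersectionMult γ) ∧
    (Finset.univ.filter fun ε : Fin (2 * n) → ℤˣ => ∑ i, (ε i : ℤ) = 0).card
      = (2 * n).choose n ∧
    (∀ ε : Fin (2 * n) → ℤˣ, ∑ i, (ε i : ℤ) = 0 →
      ∃ γ : ℂ → Fin (2 * n + 1) → ℂ, GenLame.IsSignedBranch L p ε γ ∧
        (∀ γ' : ℂ → Fin (2 * n + 1) → ℂ, GenLame.IsSignedBranch L p ε γ' →
          γ' =ᶠ[𝓝 0] γ) ∧
        4 ≤ GenLame.intersectionMult γ) := by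
  have h := GenLame.isStickelbergerPair L hp
  have hm : 0 < 2 * n := by omega
  have h1 := GenLame.sum_label_sign_eq (GenLame.wpC L p) h.symm h.diag
  refine ⟨h1, ?_, fun γ v hγ hv hvH ↦ GenLame.four_le_intersectionMult L h hm hγ hv hvH,
    GenLame.card_balanced_signs n, fun ε hε ↦ GenLame.exists_unique_signedBranch L h hm hε⟩
  rw [← h1]
  exact (h.sum_signed_sq (fun i ↦ by rw [← pow_mul, mul_comm, pow_mul, neg_one_sq, one_pow])
    (GenLame.sum_neg_one_pow_label n)).symm
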